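/- Let $[a,b]\subset\mathbb R$ be a compact interval, let $\mathbb F\in\{\mathbb R,\mathbb C\}$, and let $g:[a,b]\to\mathbb R$ be a derivator, that is, a nondecreasing, left-continuous function. Let $\mu_g$ be the Lebesgue--Stieltjes measure of $g$ on $[a,b)$, determined by $\mu_g([c,d))=g(d)-g(c)$ for $a\le c\le d\le b$, and let $L^2_g([a,b])$ be the Hilbert space of (classes of) $\mu_g$-measurable functions $f:[a,b]\to\mathbb F$ with $\|f\|_{L^2_g}^2=\int_{[a,b)}|f|^2\,d\mu_g<\infty$. Let $D_g=\{x\in[a,b): g(x^+)-g(x)>0\}$ be the set of jump points of $g$. A function $f:[a,b]\to\mathbb F$ is uniformly $g$-continuous if for every $\varepsilon>0$ there is $\delta>0$ such that $|f(x)-f(y)|<\varepsilon$ for all $x,y\in[a,b]$ with $|g(x)-g(y)|<\delta$; let $\operatorname{UC}_g([a,b])$ be the space of these functions with the supremum norm. For $x_0\in[a,b]$ the $g$-monomials centered at $x_0$ are defined by $g_{x_0,0}=1$ and, for $n\ge 1$, $$g_{x_0,n}(x)=\begin{cases} n\int_{[x_0,x)} g_{x_0,n-1}\,d\mu_g, &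 x\ge x_0,\\ -n\int_{[x,x_0)} g_{x_0,n-1}\,d\mu_g, & x<x_0,\end{cases}\qquad x\in[a,b].$$ Let ${\rm P}_g\subset \operatorname{UC}_g([a,b])$ be the space of $g$-polynomials, that is, of all finite linear combinations, with coefficients in $\mathbb F$, of $g$-monomials $g_{x_0,n}$ with $x_0\in[a,b]$ and $n\ge 0$. Theorem. ${\rm P}_g$ is dense in $\operatorname{UC}_g([a,b])$ if and only if, for every $x\in D_g$, the indicator function $1_{\{x\}}$ belongs to the closure of ${\rm P}_g$ in $L^2_g([a,b])$. -/

import Mathlib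

open Set MeasureTheory Filter Topology

noncomputable section

namespace StieltjesCalculus

/-- A derivator on `[a, b]`: a nondecreasing left-continuous function `g : [a, b] → ℝ`. -/
structure Derivator (a b : ℝ) where
  le : a ≤ b
  toFun : Icc a b → ℝ
  monotone : Monotone toFun
  leftContinuous : ∀ x, ContinuousWithinAt toFun (Iic x) x

instance (a b : ℝ) : CoeFun (Derivator a b) (fun _ => Icc a b → ℝ) := ⟨Derivator.toFun⟩

namespace Derivator

variable {a b : ℝ} (g : Derivator a b)

/-- The jump `Δg(x) = g(x⁺) - g(x)`. (At the right end point `b` Mathlib's right limit is `g b`,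
so the value is `0` there.) -/
def jump (x : Icc a b) : ℝ := Function.rightLim g x - g x

/-- The set `D_g = {x ∈ [a, b) : Δg(x) > 0}`. -/
def jumpSet : Set (Icc a b) := {x | (x : ℝ) < b ∧ 0 < g.jump x}

/-- The extension of `g` to the real line that is constant on `(-∞, a]` and on `[b, ∞)`. -/
def extend : ℝ → ℝ := IccExtend g.le g

theorem extend_monotone : Monotone g.extend := g.monotone.IccExtend g.le

/-- The Lebesgue-Stieltjes measure `μ_g` on the Borel sets of `[a, b]`. Mathlib builds
Stieltjes measures from right-continuous functions, by Carathéodory's construction; passing to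
right limits does not change the measure, and `μ_g [c, d) = g d - g c` is `measure_Ico` below.
The point `b` has measure zero, so `μ_g` is the same thing as a measure on `[a, b)`. -/
def measure : Measure (Icc a b) :=
  (g.extend_monotone.stieltjesFunction.measure).comap (Subtype.val : Icc a b → ℝ)

theorem extend_apply (x : Icc a b) : g.extend x = g x := IccExtend_val g.le g x

theorem leftLim_extend (x : Icc a b) : Function.leftLim g.extend x = g x := by
  rw [← g.extend_apply x]
  apply ContinuousWithinAt.leftLim_eq
  have h : ContinuousWithinAt (g.toFun ∘ projIcc a b g.le) (Iic (x : ℝ)) (x : ℝ) := by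
    apply ContinuousWithinAt.comp (t := Iic x)
    · have := g.leftContinuous x
      rwa [projIcc_val]
    · exact continuous_projIcc.continuousWithinAt
    · intro y hy
      have := monotone_projIcc g.le (show y ≤ (x : ℝ) from hy)
      rwa [projIcc_val] at this
  exact h

theorem leftLim_stieltjes (x : Icc a b) :
    Function.leftLim g.extend_monotone.stieltjesFunction x = g x := by
  rw [← g.leftLim_extend x]
  have : ⇑g.extend_monotone.stieltjesFunction = Function.rightLim g.extend := rfl
  rw [this]
  exact leftLim_rightLim (g.extend_monotone.tendsto_leftLim _)

/-- `μ_g [c, d) = g d - g c`. -/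
theorem measure_Ico (c d : Icc a b) : g.measure (Ico c d) = ENNReal.ofReal (g d - g c) := by
  rw [measure, Measure.comap_apply _ Subtype.val_injective
    (fun s hs => (MeasurableEmbedding.subtype_coe measurableSet_Icc).measurableSet_image.2 hs) _
    measurableSet_Ico]
  have : (Subtype.val : Icc a b → ℝ) '' Ico c d = Ico (c : ℝ) d := by
    ext y
    constructor
    · rintro ⟨z, hz, rfl⟩
      exact hz
    · intro hy
      exact ⟨⟨y, c.2.1.trans hy.1, hy.2.le.trans d.2.2⟩, hy, rfl⟩
  rw [this, StieltjesFunction.measure_Ico, leftLim_stieltjes, leftLim_stieltjes]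

/-- The right end point `b` carries no mass. -/
theorem measure_right_endpoint : g.measure {⟨b, g.le, le_rfl⟩} = 0 := by
  rw [measure, Measure.comap_apply _ Subtype.val_injective
    (fun s hs => (MeasurableEmbedding.subtype_coe measurableSet_Icc).measurableSet_image.2 hs) _
    (measurableSet_singleton _), image_singleton, StieltjesFunction.measure_singleton]
  have h := g.leftLim_stieltjes ⟨b, g.le, le_rfl⟩
  simp only at h
  rw [h]
  have h2 : g.extend_monotone.stieltjesFunction b = g ⟨b, g.le, le_rfl⟩ := by
    change Function.rightLim g.extend b = _
    apply rightLim_eq_of_tendsto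
    refine tendsto_const_nhds.congr' ?_
    filter_upwards [self_mem_nhdsWithin] with y hy
    exact (IccExtend_of_right_le g.le g (le_of_lt hy)).symm
  rw [h2]
  simp

instance : IsFiniteMeasure g.measure := by
  constructor
  have h : (univ : Set (Icc a b)) ⊆
      Ico ⟨a, le_rfl, g.le⟩ ⟨b, g.le, le_rfl⟩ ∪ {⟨b, g.le, le_rfl⟩} := by
    intro x _
    rcases x.2.2.lt_or_eq with hx | hx
    · exact Or.inl ⟨x.2.1, hx⟩
    · exact Or.inr (Subtype.ext hx)
  refine (measure_mono h).trans_lt ((measure_union_le _ _).trans_lt ?_)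
  rw [measure_right_endpoint, measure_Ico, add_zero]
  exact ENNReal.ofReal_lt_top

/-- The `g`-monomial `g_{x₀,n}` of degree `n` and center `x₀`. -/
def monomial (x₀ : Icc a b) : ℕ → Icc a b → ℝ
  | 0 => fun _ => 1
  | n + 1 => fun x =>
      if x₀ ≤ x then ((n + 1 : ℕ) : ℝ) * ∫ t in Ico x₀ x, monomial x₀ n t ∂g.measure
      else -((n + 1 : ℕ) : ℝ) * ∫ t in Ico x x₀, monomial x₀ n t ∂g.measure

variable (𝕜 : Type*) [RCLike 𝕜]

/-- The space `P_g` of `g`-polynomials: linear combinations of `g`-monomials, with arbitrary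
centers in `[a, b]` and with coefficients in `𝕜`. -/
def polynomials : Submodule 𝕜 (Icc a b → 𝕜) :=
  Submodule.span 𝕜 {p | ∃ (x₀ : Icc a b) (n : ℕ), p = fun x => (g.monomial x₀ n x : 𝕜)}

variable {𝕜}

/-- Uniform `g`-continuity. -/
def IsUniformlyContinuous (f : Icc a b → 𝕜) : Prop :=
  ∀ ε > 0, ∃ δ > 0, ∀ x y, |g x - g y| < δ → ‖f x - f y‖ < ε

variable {g}

theorem IsUniformlyContinuous.uniformContinuous {f : Icc a b → 𝕜}
    (hf : g.IsUniformlyContinuous f) :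
    @UniformContinuous _ _ (UniformSpace.comap g inferInstance) _ f := by
  let _ : PseudoMetricSpace (Icc a b) := PseudoMetricSpace.induced g inferInstance
  refine Metric.uniformContinuous_iff.2 fun ε hε => ?_
  obtain ⟨δ, hδ, h⟩ := hf ε hε
  refine ⟨δ, hδ, fun {x y} hxy => ?_⟩
  rw [dist_eq_norm]
  exact h x y hxy

theorem IsUniformlyContinuous.exists_bound {f : Icc a b → 𝕜}
    (hf : g.IsUniformlyContinuous f) : ∃ C, ∀ x, ‖f x‖ ≤ C := by
  let u : UniformSpace (Icc a b) := UniformSpace.comap g inferInstance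
  have h1 : TotallyBounded (univ : Set (Icc a b)) := by
    have hr : TotallyBounded (range g) := by
      refine (isCompact_Icc (a := g ⟨a, le_rfl, g.le⟩)
        (b := g ⟨b, g.le, le_rfl⟩)).totallyBounded.subset ?_
      rintro _ ⟨x, rfl⟩
      exact ⟨g.monotone x.2.1, g.monotone x.2.2⟩
    have := totallyBounded_preimage (f := g.toFun) ⟨rfl⟩ hr
    rwa [preimage_range] at this
  have h2 := (h1.image hf.uniformContinuous).isBounded
  rw [image_univ] at h2
  obtain ⟨C, hC⟩ := h2.exists_norm_le
  exact ⟨C, fun x => hC _ ⟨x, rfl⟩⟩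

theorem IsUniformlyContinuous.measurable {f : Icc a b → 𝕜}
    (hf : g.IsUniformlyContinuous f) : Measurable f := by
  have hc := @UniformContinuous.continuous _ _ (UniformSpace.comap g inferInstance) _ _
    hf.uniformContinuous
  refine measurable_of_isOpen fun U hU => ?_
  obtain ⟨V, hV, hVU⟩ := @Continuous.isOpen_preimage _ _
    (UniformSpace.comap g inferInstance).toTopologicalSpace _ _ hc U hU
  rw [← hVU]
  exact g.monotone.measurable hV.measurableSet

theorem IsUniformlyContinuous.integrable {f : Icc a b → 𝕜}
    (hf : g.IsUniformlyContinuous f) : Integrable f g.measure := by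
  obtain ⟨C, hC⟩ := hf.exists_bound
  exact Integrable.of_bound hf.measurable.aestronglyMeasurable C (Eventually.of_forall hC)

theorem IsUniformlyContinuous.memLp {f : Icc a b → 𝕜}
    (hf : g.IsUniformlyContinuous f) : MemLp f 2 g.measure := by
  obtain ⟨C, hC⟩ := hf.exists_bound
  exact MemLp.of_bound hf.measurable.aestronglyMeasurable C (Eventually.of_forall hC)

variable (𝕜) (g)

/-- The linear space of uniformly `g`-continuous functions on `[a, b]`. -/
def ucSubmodule : Submodule 𝕜 (Icc a b → 𝕜) where
  carrier := {f | g.IsUniformlyContinuous f}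
  zero_mem' := fun ε hε => ⟨1, one_pos, fun x y _ => by simpa using hε⟩
  add_mem' := by
    intro f h hf hh ε hε
    obtain ⟨δ₁, h₁, H₁⟩ := hf (ε / 2) (half_pos hε)
    obtain ⟨δ₂, h₂, H₂⟩ := hh (ε / 2) (half_pos hε)
    refine ⟨min δ₁ δ₂, lt_min h₁ h₂, fun x y hxy => ?_⟩
    have e : (f + h) x - (f + h) y = (f x - f y) + (h x - h y) := by
      simp only [Pi.add_apply]; ring
    rw [e]
    have k₁ := H₁ x y (hxy.trans_le (min_le_left _ _))
    have k₂ := H₂ x y (hxy.trans_le (min_le_right _ _))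
    linarith [norm_add_le (f x - f y) (h x - h y)]
  smul_mem' := by
    intro c f hf ε hε
    have hc : 0 < ‖c‖ + 1 := by positivity
    obtain ⟨δ, hδ, H⟩ := hf (ε / (‖c‖ + 1)) (by positivity)
    refine ⟨δ, hδ, fun x y hxy => ?_⟩
    have e : (c • f) x - (c • f) y = c * (f x - f y) := by
      simp only [Pi.smul_apply, smul_eq_mul]; ring
    rw [e, norm_mul]
    have k := H x y hxy
    rw [lt_div_iff₀ hc] at k
    nlinarith [norm_nonneg (f x - f y), norm_nonneg c]

theorem isUniformlyContinuous_monomial (x₀ : Icc a b) (n : ℕ) :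
    g.IsUniformlyContinuous (g.monomial x₀ n) := by
  induction n with
  | zero => exact fun ε hε => ⟨1, one_pos, fun x y _ => by simpa [monomial] using hε⟩
  | succ n ih =>
    obtain ⟨C, hC⟩ := ih.exists_bound
    have hC0 : 0 ≤ C := (norm_nonneg _).trans (hC x₀)
    have hint := ih.integrable
    -- a primitive based at the left end point
    let l : Icc a b := ⟨a, le_rfl, g.le⟩
    let F : Icc a b → ℝ := fun x => ∫ t in Ico l x, g.monomial x₀ n t ∂g.measure
    have hF : ∀ x y, x ≤ y → F y - F x = ∫ t in Ico x y, g.monomial x₀ n t ∂g.measure := by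
      intro x y hxy
      have hu : Ico l y = Ico l x ∪ Ico x y :=
        (Ico_union_Ico_eq_Ico (show l ≤ x from x.2.1) hxy).symm
      simp only [F]
      rw [hu, setIntegral_union (Ico_disjoint_Ico_same) measurableSet_Ico
        hint.integrableOn hint.integrableOn]
      ring
    have hmono : ∀ x, g.monomial x₀ (n + 1) x = ((n + 1 : ℕ) : ℝ) * (F x - F x₀) := by
      intro x
      simp only [monomial]
      split_ifs with h
      · rw [hF _ _ h]
      · rw [← hF _ _ (le_of_not_ge h)]
        ring
    have hle : ∀ x y, x ≤ y → |F y - F x| ≤ C * (g y - g x) := by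
      intro x y hxy
      rw [hF x y hxy]
      have := norm_setIntegral_le_of_norm_le_const (μ := g.measure) (s := Ico x y)
        (f := g.monomial x₀ n) (C := C) (measure_lt_top _ _) (fun t _ => hC t)
      rwa [measureReal_def, measure_Ico,
        ENNReal.toReal_ofReal (sub_nonneg.2 (g.monotone hxy))] at this
    have hle' : ∀ x y, |F x - F y| ≤ C * |g x - g y| := by
      intro x y
      rcases le_total x y with h | h
      · have := hle x y h
        rwa [abs_sub_comm, abs_sub_comm (g x), abs_of_nonneg (sub_nonneg.2 (g.monotone h))]
      · have := hle y x h
        rwa [abs_of_nonneg (sub_nonneg.2 (g.monotone h))]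
    intro ε hε
    have hK : 0 < ((n + 1 : ℕ) : ℝ) * C + 1 := by positivity
    refine ⟨ε / (((n + 1 : ℕ) : ℝ) * C + 1), by positivity, fun x y hxy => ?_⟩
    rw [hmono, hmono, Real.norm_eq_abs]
    have e : ((n + 1 : ℕ) : ℝ) * (F x - F x₀) - ((n + 1 : ℕ) : ℝ) * (F y - F x₀)
        = ((n + 1 : ℕ) : ℝ) * (F x - F y) := by ring
    rw [e, abs_mul, abs_of_nonneg (Nat.cast_nonneg _)]
    rw [lt_div_iff₀ hK] at hxy
    calc ((n + 1 : ℕ) : ℝ) * |F x - F y|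
        ≤ ((n + 1 : ℕ) : ℝ) * (C * |g x - g y|) := by gcongr; exact hle' x y
      _ ≤ |g x - g y| * (((n + 1 : ℕ) : ℝ) * C + 1) := by
          nlinarith [abs_nonneg (g x - g y)]
      _ < ε := hxy

/-- Every `g`-polynomial is uniformly `g`-continuous. -/
theorem polynomials_le_ucSubmodule : g.polynomials 𝕜 ≤ g.ucSubmodule 𝕜 := by
  refine Submodule.span_le.2 ?_
  rintro _ ⟨x₀, n, rfl⟩ ε hε
  obtain ⟨δ, hδ, H⟩ := g.isUniformlyContinuous_monomial x₀ n ε hε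
  refine ⟨δ, hδ, fun x y hxy => ?_⟩
  rw [← RCLike.ofReal_sub, RCLike.norm_ofReal]
  exact H x y hxy

/-- The space `UC_g([a, b])` of uniformly `g`-continuous functions `f : [a, b] → 𝕜`. -/
def UC : Type _ := g.ucSubmodule 𝕜

namespace UC

instance : CoeFun (g.UC 𝕜) (fun _ => Icc a b → 𝕜) := ⟨Subtype.val⟩

instance : AddCommGroup (g.UC 𝕜) := inferInstanceAs (AddCommGroup (g.ucSubmodule 𝕜))

instance : Module 𝕜 (g.UC 𝕜) := inferInstanceAs (Module 𝕜 (g.ucSubmodule 𝕜))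

variable {𝕜 g}

theorem bddAbove (f : g.UC 𝕜) : BddAbove (range fun x => ‖f x‖) := by
  obtain ⟨C, hC⟩ := IsUniformlyContinuous.exists_bound f.2
  exact ⟨C, by rintro _ ⟨x, rfl⟩; exact hC x⟩

variable (𝕜 g)

/-- The supremum norm on `UC_g([a, b])`. -/
def supNorm : AddGroupNorm (g.UC 𝕜) where
  toFun f := ⨆ x, ‖f x‖
  map_zero' := by
    change ⨆ x : Icc a b, ‖(0 : 𝕜)‖ = 0
    simp
  add_le' f h := by
    have : Nonempty (Icc a b) := ⟨⟨a, le_rfl, g.le⟩⟩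
    refine ciSup_le fun x => ?_
    exact (norm_add_le (f x) (h x)).trans (add_le_add (le_ciSup f.bddAbove x)
      (le_ciSup h.bddAbove x))
  neg' f := by
    change ⨆ x, ‖-(f x)‖ = _
    simp only [norm_neg]
  eq_zero_of_map_eq_zero' f hf := by
    refine Subtype.ext (funext fun x => ?_)
    have := le_ciSup f.bddAbove x
    exact norm_le_zero_iff.1 (this.trans hf.le)

/-- `UC_g([a, b])` with the supremum norm. -/
instance : NormedAddCommGroup (g.UC 𝕜) := (supNorm g 𝕜).toNormedAddCommGroup

theorem norm_def (f : g.UC 𝕜) : ‖f‖ = ⨆ x, ‖f x‖ := rfl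

instance : NormedSpace 𝕜 (g.UC 𝕜) where
  norm_smul_le c f := by
    have : Nonempty (Icc a b) := ⟨⟨a, le_rfl, g.le⟩⟩
    refine ciSup_le fun x => ?_
    change ‖c * f x‖ ≤ _
    rw [norm_mul]
    exact mul_le_mul_of_nonneg_left (le_ciSup f.bddAbove x) (norm_nonneg c)

end UC

/-- `P_g` as a linear subspace of `UC_g([a, b])` (it is contained in `UC_g([a, b])` by
`polynomials_le_ucSubmodule`). -/
def polynomialsUC : Submodule 𝕜 (g.UC 𝕜) :=
  (g.polynomials 𝕜).comap (g.ucSubmodule 𝕜).subtype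

/-- The space `L²_g([a, b])`. -/
abbrev L2 : Type _ := Lp 𝕜 2 g.measure

/-- The inclusion of `UC_g([a, b])` in `L²_g([a, b])`. -/
def UC.toL2 : g.UC 𝕜 →ₗ[𝕜] g.L2 𝕜 where
  toFun f := (IsUniformlyContinuous.memLp f.2).toLp f
  map_add' _ _ := rfl
  map_smul' _ _ := rfl

/-- `P_g` as a linear subspace of `L²_g([a, b])`. -/
def polynomialsL2 : Submodule 𝕜 (g.L2 𝕜) := (g.polynomialsUC 𝕜).map (UC.toL2 g 𝕜)

/-- The class of the indicator function `1_{x}` in `L²_g([a, b])`. -/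
def indicatorL2 (x : Icc a b) : g.L2 𝕜 :=
  indicatorConstLp 2 (measurableSet_singleton x) (measure_ne_top g.measure {x}) (1 : 𝕜)

end Derivator

end StieltjesCalculus

end

/-! Write `μ` for `μ_g`, and let the primitive of `φ` be `x ↦ ∫_{[a,x)} φ dμ`. By Cauchy–Schwarz it
is continuous from `L²_g` to `UC_g`, and it maps `g`-polynomials to `g`-polynomials. So it carries
the `L²_g`-closure of `P_g` into the uniform closure of `P_g`.

If `P_g` is dense in `UC_g`, its `L²_g`-closure contains every uniformly `g`-continuous function.
Tents in `g` converge to the indicator of the level set `{g = g x}`, which at a jump point `x`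
equals `{x}` up to a null set (`level_ae_eq_singleton`).

Conversely, let the indicators of the atoms be `L²_g`-limits of `g`-polynomials; so is then every
function carried by the atoms. Let `u` be the distribution function of the atomless part of `μ`. If
`u ^ n` is a uniform limit of `g`-polynomials, cutting it off on the atoms stays in the
`L²_g`-closure, and the primitive of the result is `u ^ (n + 1) / (n + 1)`. Hence all powers of `u`
are uniform limits (`pow_mem_closure`). By Weierstrass, so is whatever is uniformly continuous in
`u`, in particular the primitive of any `L²_g` function vanishing on the atoms. Adding the atomic
part, all primitives of `L²_g` functions are reached. The powers of `g - g a` are such primitives,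
up to constants, so a second use of Weierstrass, in the variable `g`, yields all of `UC_g`. -/

namespace StieltjesCalculus

/-! ### Weierstrass approximation in the variable `u` -/

section Approximation

variable {X : Type*} [Nonempty X]

/-- A bounded real function which is uniformly continuous with respect to a function `u` is
uniformly close to a continuous function of `u`. -/
theorem exists_continuous_comp_near {u f : X → ℝ} {C : ℝ} (hC : ∀ x, |f x| ≤ C)
    (hf : ∀ ε > 0, ∃ δ > 0, ∀ x y, |u x - u y| < δ → |f x - f y| < ε) {ε : ℝ} (hε : 0 < ε) :
    ∃ h : ℝ → ℝ, Continuous h ∧ ∀ x, |f x - h (u x)| ≤ ε := by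
  obtain ⟨δ, hδ, H⟩ := hf ε hε
  have hC0 : 0 ≤ C := (abs_nonneg _).trans (hC (Classical.arbitrary X))
  -- Chosen so that `K * δ = 2 * C` bounds the oscillation of `f`: points at `u`-distance at least
  -- `δ` cannot push the infimum below `f y`.
  set K : ℝ := 2 * C / δ with hK
  have hK0 : 0 ≤ K := by positivity
  have hb : ∀ s, BddBelow (range fun x => f x + K * |s - u x|) := by
    rintro s
    refine ⟨-C, ?_⟩
    rintro _ ⟨x, rfl⟩
    have := (abs_le.1 (hC x)).1
    have : 0 ≤ K * |s - u x| := by positivity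
    simp only
    linarith
  -- Inf-convolution, an infimum of `K`-Lipschitz functions of `s`.
  refine ⟨fun s => ⨅ x, (f x + K * |s - u x|), ?_, ?_⟩
  · refine (LipschitzWith.of_le_add_mul K.toNNReal fun s t => ?_).continuous
    rw [Real.coe_toNNReal _ hK0, ← sub_le_iff_le_add]
    refine le_ciInf fun x => ?_
    have h1 := ciInf_le (hb s) x
    have h2 : K * |s - u x| ≤ K * (|t - u x| + dist s t) := by
      gcongr
      rw [Real.dist_eq]
      linarith [abs_sub_le s t (u x)]
    linarith
  · intro y
    have h1 := ciInf_le (hb (u y)) y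
    simp only [sub_self, abs_zero, mul_zero, add_zero] at h1
    have h2 : f y - ε ≤ ⨅ x, (f x + K * |u y - u x|) := by
      refine le_ciInf fun x => ?_
      by_cases hxy : |u y - u x| < δ
      · have := (abs_lt.1 (H y x hxy)).2
        have : 0 ≤ K * |u y - u x| := by positivity
        linarith
      · have h3 : K * δ ≤ K * |u y - u x| := by gcongr; exact not_lt.1 hxy
        rw [hK, div_mul_cancel₀ _ hδ.ne', ← hK] at h3
        have := (abs_le.1 (hC x)).1
        have := (abs_le.1 (hC y)).2
        linarith
    rw [abs_le]
    constructor <;> linarith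

/-- Weierstrass approximation of a bounded function which is uniformly continuous with respect to
a bounded function `u` by real polynomials in `u`. -/
theorem exists_real_polynomial_comp_near {u f : X → ℝ} {B C : ℝ} (hB : ∀ x, |u x| ≤ B)
    (hC : ∀ x, |f x| ≤ C)
    (hf : ∀ ε > 0, ∃ δ > 0, ∀ x y, |u x - u y| < δ → |f x - f y| < ε) {ε : ℝ} (hε : 0 < ε) :
    ∃ q : Polynomial ℝ, ∀ x, |f x - q.eval (u x)| < ε := by
  obtain ⟨h, hh, H⟩ := exists_continuous_comp_near hC hf (half_pos hε)
  obtain ⟨q, hq⟩ := exists_polynomial_near_of_continuousOn (-B) B h hh.continuousOn _ (half_pos hε)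
  refine ⟨q, fun x => ?_⟩
  have h1 := H x
  have h2 := hq (u x) (abs_le.1 (hB x))
  rw [abs_sub_comm] at h2
  linarith [abs_sub_le (f x) (h (u x)) (q.eval (u x))]

/-- Weierstrass approximation of a bounded function which is uniformly continuous with respect to
a bounded function `u` by polynomials in `u`. -/
theorem exists_polynomial_comp_near {𝕜 : Type*} [RCLike 𝕜] {u : X → ℝ} {f : X → 𝕜} {B C : ℝ}
    (hB : ∀ x, |u x| ≤ B) (hC : ∀ x, ‖f x‖ ≤ C)
    (hf : ∀ ε > 0, ∃ δ > 0, ∀ x y, |u x - u y| < δ → ‖f x - f y‖ < ε) {ε : ℝ} (hε : 0 < ε) :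
    ∃ q : Polynomial 𝕜, ∀ x, ‖f x - q.eval (u x : 𝕜)‖ < ε := by
  have eval_map : ∀ (q : Polynomial ℝ) (t : ℝ),
      (q.map (algebraMap ℝ 𝕜)).eval (t : 𝕜) = ((q.eval t : ℝ) : 𝕜) := fun q t => by
    rw [← RCLike.algebraMap_eq_ofReal, Polynomial.eval_map, Polynomial.eval₂_at_apply]
  obtain ⟨p, hp⟩ := exists_real_polynomial_comp_near (f := fun x => RCLike.re (f x)) hB
    (fun x => (RCLike.abs_re_le_norm _).trans (hC x))
    (fun ε hε => (hf ε hε).imp fun δ h => ⟨h.1, fun x y hxy => by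
      rw [← map_sub]; exact (RCLike.abs_re_le_norm _).trans_lt (h.2 x y hxy)⟩) (half_pos hε)
  obtain ⟨q, hq⟩ := exists_real_polynomial_comp_near (f := fun x => RCLike.im (f x)) hB
    (fun x => (RCLike.abs_im_le_norm _).trans (hC x))
    (fun ε hε => (hf ε hε).imp fun δ h => ⟨h.1, fun x y hxy => by
      rw [← map_sub]; exact (RCLike.abs_im_le_norm _).trans_lt (h.2 x y hxy)⟩) (half_pos hε)
  refine ⟨p.map (algebraMap ℝ 𝕜) + Polynomial.C (RCLike.I : 𝕜) * q.map (algebraMap ℝ 𝕜),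
    fun x => ?_⟩
  rw [Polynomial.eval_add, Polynomial.eval_mul, Polynomial.eval_C, eval_map, eval_map]
  have e : f x - (((p.eval (u x) : ℝ) : 𝕜) + RCLike.I * ((q.eval (u x) : ℝ) : 𝕜)) =
      ((RCLike.re (f x) - p.eval (u x) : ℝ) : 𝕜) +
        ((RCLike.im (f x) - q.eval (u x) : ℝ) : 𝕜) * RCLike.I := by
    conv_lhs => rw [← RCLike.re_add_im (f x)]
    push_cast
    ring
  rw [e]
  refine (norm_add_le _ _).trans_lt ?_
  rw [norm_mul, RCLike.norm_ofReal, RCLike.norm_ofReal]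
  -- `‖I‖` is `0` over the reals and `1` over the complex numbers.
  have h1 : |RCLike.im (f x) - q.eval (u x)| * ‖(RCLike.I : 𝕜)‖ ≤
      |RCLike.im (f x) - q.eval (u x)| :=
    mul_le_of_le_one_right (abs_nonneg _) (by
      rw [RCLike.norm_I]; split_ifs <;> norm_num)
  linarith [hp x, hq x]

end Approximation

/-! ### Distribution functions and the product rule in the presence of atoms -/

section Primitive

variable {X : Type*} [LinearOrder X] [MeasurableSpace X]

section

variable (ν : Measure X)

theorem monotone_measureReal_Iio [IsFiniteMeasure ν] : Monotone fun x => ν.real (Iio x) := fun _ _ h =>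
  measureReal_mono (Iio_subset_Iio h)

theorem monotone_measureReal_Iic [IsFiniteMeasure ν] : Monotone fun x => ν.real (Iic x) := fun _ _ h =>
  measureReal_mono (Iic_subset_Iic.2 h)
variable {ν}

/-- The density of the `(n + 1)`-st power of the distribution function of `ν`. -/
def powDensity (ν : Measure X) (n : ℕ) (t : X) : ℝ :=
  ∑ i ∈ Finset.range (n + 1), ν.real (Iio t) ^ i * ν.real (Iic t) ^ (n - i)

theorem powDensity_succ (n : ℕ) (t : X) : powDensity ν (n + 1) t =
    ν.real (Iio t) ^ (n + 1) + ν.real (Iic t) * powDensity ν n t :=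
  geom_sum₂_succ_eq _ _

theorem norm_powDensity_le [IsFiniteMeasure ν] (n : ℕ) (t : X) :
    ‖powDensity ν n t‖ ≤ ∑ i ∈ Finset.range (n + 1), ν.real univ ^ i * ν.real univ ^ (n - i) := by
  rw [powDensity, Real.norm_of_nonneg (Finset.sum_nonneg fun _ _ => by positivity)]
  exact Finset.sum_le_sum fun i _ => by gcongr <;> simp

/-- Without an atom at `t` the two one-sided values agree, and the `n + 1` summands coincide. -/
theorem powDensity_eq_of_measure_singleton {t : X} (ht : ν {t} = 0) (n : ℕ) :
    powDensity ν n t = (n + 1) * ν.real (Iio t) ^ n := by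
  have h : ν.real (Iic t) = ν.real (Iio t) := by
    refine measureReal_congr ?_
    rw [← Iio_union_right]
    exact union_ae_eq_left_of_ae_eq_empty (ae_eq_empty.2 ht)
  rw [powDensity, h, Finset.sum_congr rfl (g := fun _ => ν.real (Iio t) ^ n)]
  · simp
  · intro i hi
    rw [← pow_add, Nat.add_sub_cancel' (Nat.lt_succ_iff.1 (Finset.mem_range.1 hi))]

end

variable [TopologicalSpace X] [OrderTopology X]
  [SecondCountableTopology X] [BorelSpace X] {ν : Measure X} [IsFiniteMeasure ν]

/-- The product of two primitives is a primitive. -/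
theorem setIntegral_Iio_mul_setIntegral_Iio {f h : X → ℝ} (hf : Integrable f ν)
    (hh : Integrable h ν) (x : X) :
    (∫ t in Iio x, f t ∂ν) * ∫ t in Iio x, h t ∂ν =
      ∫ t in Iio x, (f t * (∫ s in Iic t, h s ∂ν) + (∫ s in Iio t, f s ∂ν) * h t) ∂ν := by
  set ρ := ν.restrict (Iio x) with hρ
  have hf' : Integrable f ρ := hf.restrict
  have hh' : Integrable h ρ := hh.restrict
  have hF : Integrable (fun z : X × X => f z.1 * h z.2) (ρ.prod ρ) := hf'.mul_prod hh'
  -- Fubini on the square, cut along the diagonal. The diagonal goes to one half only, hence `Iic`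
  -- in one term and `Iio` in the other.
  have hm : MeasurableSet {z : X × X | z.2 ≤ z.1} := measurableSet_le measurable_snd measurable_fst
  have h1 := integral_add_compl hm hF
  rw [integral_prod_mul, ← integral_indicator hm, ← integral_indicator hm.compl] at h1
  rw [← h1, integral_prod _ (hF.indicator hm), integral_prod_symm _ (hF.indicator hm.compl),
    ← integral_add (hF.indicator hm).integral_prod_left (hF.indicator hm.compl).integral_prod_right]
  refine integral_congr_ae ?_
  filter_upwards [ae_restrict_mem measurableSet_Iio] with t ht
  congr 1
  · have : ∀ s, {z : X × X | z.2 ≤ z.1}.indicator (fun z : X × X => f z.1 * h z.2) (t, s) =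
        f t * (Iic t).indicator h s := by
      intro s
      by_cases hs : s ≤ t <;> simp [indicator, hs]
    simp_rw [this]
    rw [integral_const_mul, integral_indicator measurableSet_Iic, hρ,
      Measure.restrict_restrict measurableSet_Iic]
    congr 3
    exact inter_eq_left.2 fun s hs => lt_of_le_of_lt hs ht
  · have : ∀ s, {z : X × X | z.2 ≤ z.1}ᶜ.indicator (fun z : X × X => f z.1 * h z.2) (s, t) =
        (Iio t).indicator f s * h t := by
      intro s
      by_cases hs : s < t
      · simp [indicator, hs]
      · simp [indicator, hs, not_lt.1 hs]
    simp_rw [this]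
    rw [integral_mul_const, integral_indicator measurableSet_Iio, hρ,
      Measure.restrict_restrict measurableSet_Iio]
    congr 3
    exact inter_eq_left.2 fun s hs => lt_trans hs ht

omit [SecondCountableTopology X] in
theorem measurable_powDensity (n : ℕ) : Measurable (powDensity ν n) :=
  Finset.measurable_sum _ fun _ _ => ((monotone_measureReal_Iio ν).measurable.pow_const _).mul
    ((monotone_measureReal_Iic ν).measurable.pow_const _)

omit [SecondCountableTopology X] in
theorem integrable_powDensity (n : ℕ) : Integrable (powDensity ν n) ν :=
  Integrable.of_bound (measurable_powDensity n).aestronglyMeasurable _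
    (Eventually.of_forall (norm_powDensity_le n))

/-- At an atom this is the factorization of `A ^ (n + 1) - B ^ (n + 1)` by `A - B`. In general it
follows by induction from the product rule with second factor `1`. -/
theorem setIntegral_powDensity (n : ℕ) (x : X) :
    ∫ t in Iio x, powDensity ν n t ∂ν = ν.real (Iio x) ^ (n + 1) := by
  induction n generalizing x with
  | zero => simp [powDensity]
  | succ n ih =>
    have h := setIntegral_Iio_mul_setIntegral_Iio (integrable_powDensity n)
      (integrable_const (1 : ℝ)) (ν := ν) x
    simp only [ih, setIntegral_const, smul_eq_mul, mul_one] at h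
    rw [pow_succ, h]
    refine integral_congr_ae (Eventually.of_forall fun t => ?_)
    simp only [powDensity_succ]
    ring

/-- Strictly to the left of `x`, the level set of `x` for the distribution function is null. -/
theorem measure_level_left_eq_zero (x : X) : ν {y | y < x ∧ ν (Ico y x) = 0} = 0 := by
  set N := {y | y < x ∧ ν (Ico y x) = 0} with hN
  have hm : MeasurableSet N := by
    have : OrdConnected N := by
      refine ⟨fun y hy z hz t ht => ⟨ht.2.trans_lt hz.1, measure_mono_null ?_ hy.2⟩⟩
      exact Ico_subset_Ico_left ht.1
    exact this.measurableSet
  set ρ := ν.restrict N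
  have h0 : ∀ y ∈ N, ρ (Ici y) = 0 := by
    intro y hy
    rw [Measure.restrict_apply measurableSet_Ici]
    exact measure_mono_null (show Ici y ∩ N ⊆ Ico y x from fun z hz => ⟨hz.1, hz.2.1⟩) hy.2
  -- `N` may have no least element, so no single interval need cover it. Instead almost every slice
  -- of this half of the square is null, and by symmetry so is the whole square.
  have h1 : (ρ.prod ρ) {z : X × X | z.1 ≤ z.2} = 0 := by
    rw [Measure.measure_prod_null (measurableSet_le measurable_fst measurable_snd)]
    filter_upwards [ae_restrict_mem hm] with y hy using h0 y hy
  have h2 : (ρ.prod ρ) {z : X × X | z.2 ≤ z.1} = 0 := by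
    rw [← Measure.prod_swap, Measure.map_apply measurable_swap
      (measurableSet_le measurable_snd measurable_fst)]
    exact h1
  have h3 : (ρ.prod ρ) univ = 0 :=
    measure_mono_null (fun z _ => (le_total z.1 z.2)) (measure_union_null h1 h2)
  rw [← univ_prod_univ, Measure.prod_prod, mul_self_eq_zero, Measure.restrict_apply_univ] at h3
  exact h3

end Primitive

noncomputable section

namespace Derivator

variable {a b : ℝ} (g : Derivator a b)

/-! ### The jumps of the derivator -/

theorem Ico_left_eq_Iio (x : Icc a b) : Ico ⟨a, le_rfl, g.le⟩ x = Iio x :=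
  Set.ext fun y => ⟨fun h => h.2, fun h => ⟨y.2.1, h⟩⟩

theorem measureReal_Ico {x y : Icc a b} (h : x ≤ y) : g.measure.real (Ico x y) = g y - g x := by
  rw [measureReal_def, measure_Ico, ENNReal.toReal_ofReal (sub_nonneg.2 (g.monotone h))]

theorem measureReal_Iio (x : Icc a b) :
    g.measure.real (Iio x) = g x - g ⟨a, le_rfl, g.le⟩ := by
  rw [← g.Ico_left_eq_Iio, g.measureReal_Ico x.2.1]

theorem rightLim_eq_of_notMem_jumpSet {x : Icc a b} (hx : (x : ℝ) < b) (h : x ∉ g.jumpSet) :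
    Function.rightLim g x = g x := by
  have h1 : ¬ 0 < g.jump x := fun h' => h ⟨hx, h'⟩
  have h2 := g.monotone.le_rightLim (le_refl x)
  rw [jump] at h1
  linarith

theorem measure_singleton_of_notMem_jumpSet {x : Icc a b} (h : x ∉ g.jumpSet) :
    g.measure {x} = 0 := by
  rcases x.2.2.lt_or_eq with hx | hx
  · have h1 := g.rightLim_eq_of_notMem_jumpSet hx h
    have hne : (𝓝[>] x).NeBot :=
      nhdsGT_neBot_of_exists_gt ⟨⟨b, g.le, le_rfl⟩, hx⟩
    have h2 : Tendsto g (𝓝[>] x) (𝓝 (g x)) := h1 ▸ g.monotone.tendsto_rightLim x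
    have h3 : Tendsto (fun y => ENNReal.ofReal (g y - g x)) (𝓝[>] x) (𝓝 0) := by
      have := ENNReal.tendsto_ofReal (h2.sub_const (g x))
      rwa [sub_self, ENNReal.ofReal_zero] at this
    refine le_antisymm (ge_of_tendsto h3 ?_) bot_le
    filter_upwards [self_mem_nhdsWithin] with y hy
    rw [← g.measure_Ico]
    exact measure_mono (singleton_subset_iff.2 ⟨le_rfl, hy⟩)
  · have : x = ⟨b, g.le, le_rfl⟩ := Subtype.ext hx
    rw [this]
    exact g.measure_right_endpoint

/-- The set of atoms of `μ_g`. -/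
def atoms : Set (Icc a b) := {x | 0 < g.measure {x}}

theorem atoms_countable : g.atoms.Countable :=
  Measure.countable_meas_pos_of_disjoint_iUnion (fun _ => measurableSet_singleton _)
    fun _ _ h => disjoint_singleton.2 h

theorem measurableSet_atoms : MeasurableSet g.atoms := g.atoms_countable.measurableSet

theorem atoms_subset_jumpSet : g.atoms ⊆ g.jumpSet := fun x hx => by
  by_contra h
  exact hx.ne' (g.measure_singleton_of_notMem_jumpSet h)

variable (𝕜 : Type*) [RCLike 𝕜] {g}

/-! ### The supremum norm and the embedding in `L²_g` -/

variable {𝕜}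

theorem UC.norm_apply_le (f : g.UC 𝕜) (x : Icc a b) : ‖f x‖ ≤ ‖f‖ := le_ciSup f.bddAbove x

theorem UC.norm_le {f : g.UC 𝕜} {C : ℝ} (h : ∀ x, ‖f x‖ ≤ C) : ‖f‖ ≤ C :=
  have : Nonempty (Icc a b) := ⟨⟨a, le_rfl, g.le⟩⟩
  ciSup_le h

variable (g 𝕜)

theorem UC.coeFn_toL2 (f : g.UC 𝕜) : UC.toL2 g 𝕜 f =ᵐ[g.measure] f :=
  MemLp.coeFn_toLp (IsUniformlyContinuous.memLp f.2)

theorem UC.continuous_toL2 : Continuous (UC.toL2 g 𝕜) := by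
  refine AddMonoidHomClass.continuous_of_bound (UC.toL2 g 𝕜)
    (g.measure.real univ ^ (2 : ENNReal).toReal⁻¹) fun f => ?_
  have h := Lp.norm_le_of_ae_bound (f := UC.toL2 g 𝕜 f) (norm_nonneg f) (by
    filter_upwards [UC.coeFn_toL2 g 𝕜 f] with x hx
    rw [hx]
    exact f.norm_apply_le x)
  exact h

/-! ### Primitives -/

variable {g 𝕜}

theorem integrable_L2 (φ : g.L2 𝕜) : Integrable φ g.measure :=
  (Lp.memLp φ).integrable one_le_two

/-- Cauchy–Schwarz against the indicator of `s`. -/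
theorem norm_setIntegral_L2_le (φ : g.L2 𝕜) {s : Set (Icc a b)} (hs : MeasurableSet s) :
    ‖∫ t in s, φ t ∂g.measure‖ ≤ √(g.measure.real s) * ‖φ‖ := by
  rw [← L2.inner_indicatorConstLp_one hs (measure_ne_top _ _)]
  refine (norm_inner_le_norm _ _).trans (le_of_eq ?_)
  rw [norm_indicatorConstLp two_ne_zero ENNReal.ofNat_ne_top, Real.sqrt_eq_rpow]
  simp

theorem setIntegral_Iio_sub {f : Icc a b → 𝕜} (hf : Integrable f g.measure) {x y : Icc a b}
    (h : x ≤ y) : (∫ t in Iio y, f t ∂g.measure) - ∫ t in Iio x, f t ∂g.measure =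
      ∫ t in Ico x y, f t ∂g.measure := by
  rw [← Iio_union_Ico_eq_Iio h, setIntegral_union _ measurableSet_Ico hf.integrableOn
    hf.integrableOn, add_sub_cancel_left]
  exact disjoint_left.2 fun t h1 h2 => not_le.2 h1 h2.1

/-- A primitive of an `L²_g` function vanishing off `s` is `1/2`-Hölder continuous with respect to
the distribution function of the restriction of `μ_g` to `s`. -/
theorem norm_setIntegral_Iio_sub_le (φ : g.L2 𝕜) {s : Set (Icc a b)} (hs : MeasurableSet s)
    (x y : Icc a b) :
    ‖(∫ t in Iio x, s.indicator φ t ∂g.measure) - ∫ t in Iio y, s.indicator φ t ∂g.measure‖ ≤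
      √|(g.measure.restrict s).real (Iio x) - (g.measure.restrict s).real (Iio y)| * ‖φ‖ := by
  wlog h : y ≤ x generalizing x y
  · rw [norm_sub_rev, abs_sub_comm]
    exact this y x (le_of_not_ge h)
  have e : (g.measure.restrict s).real (Iio x) - (g.measure.restrict s).real (Iio y) =
      g.measure.real (Ico y x ∩ s) := by
    rw [← measureReal_restrict_apply measurableSet_Ico, ← Iio_union_Ico_eq_Iio h,
      measureReal_union _ measurableSet_Ico, add_sub_cancel_left]
    exact disjoint_left.2 fun t h1 h2 => not_le.2 h1 h2.1
  rw [setIntegral_Iio_sub ((integrable_L2 φ).indicator hs) h, setIntegral_indicator hs, e,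
    abs_of_nonneg measureReal_nonneg]
  exact norm_setIntegral_L2_le φ (measurableSet_Ico.inter hs)

theorem isUniformlyContinuous_of_norm_sub_le {f : Icc a b → 𝕜} {u : Icc a b → ℝ} {C ε : ℝ}
    (h : ∀ x y, ‖f x - f y‖ ≤ √|u x - u y| * C) (hε : 0 < ε) :
    ∃ δ > 0, ∀ x y, |u x - u y| < δ → ‖f x - f y‖ < ε := by
  have hC : 0 < |C| + 1 := by positivity
  refine ⟨(ε / (|C| + 1)) ^ 2, by positivity, fun x y hxy => (h x y).trans_lt ?_⟩
  have h1 : √|u x - u y| < ε / (|C| + 1) := (Real.sqrt_lt' (by positivity)).2 hxy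
  rw [lt_div_iff₀ hC] at h1
  refine lt_of_le_of_lt ?_ h1
  gcongr
  linarith [le_abs_self C]

theorem isUniformlyContinuous_primitive (φ : g.L2 𝕜) :
    g.IsUniformlyContinuous fun x => ∫ t in Iio x, φ t ∂g.measure := by
  intro ε hε
  have h := fun x y => norm_setIntegral_Iio_sub_le φ MeasurableSet.univ x y
  simp only [indicator_univ, Measure.restrict_univ, measureReal_Iio, sub_sub_sub_cancel_right] at h
  exact isUniformlyContinuous_of_norm_sub_le h hε

variable (g 𝕜)

/-- The primitive `φ ↦ ∫_{[a, ·)} φ dμ_g` as a map from `L²_g` to `UC_g`. -/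
def primitive : g.L2 𝕜 →ₗ[𝕜] g.UC 𝕜 where
  toFun φ := ⟨fun x => ∫ t in Iio x, φ t ∂g.measure, isUniformlyContinuous_primitive φ⟩
  map_add' φ ψ := Subtype.ext <| funext fun x => by
    change ∫ t in Iio x, (φ + ψ : g.L2 𝕜) t ∂g.measure =
      (∫ t in Iio x, φ t ∂g.measure) + ∫ t in Iio x, ψ t ∂g.measure
    rw [← integral_add (integrable_L2 φ).integrableOn (integrable_L2 ψ).integrableOn]
    exact integral_congr_ae (ae_restrict_of_ae (Lp.coeFn_add φ ψ))
  map_smul' c φ := Subtype.ext <| funext fun x => by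
    change ∫ t in Iio x, (c • φ : g.L2 𝕜) t ∂g.measure = c * ∫ t in Iio x, φ t ∂g.measure
    rw [← integral_const_mul]
    exact integral_congr_ae (ae_restrict_of_ae (Lp.coeFn_smul c φ))

variable {𝕜}

theorem primitive_toLp_apply {f : Icc a b → 𝕜} (hf : MemLp f 2 g.measure) (x : Icc a b) :
    g.primitive 𝕜 (hf.toLp f) x = ∫ t in Iio x, f t ∂g.measure :=
  integral_congr_ae (ae_restrict_of_ae hf.coeFn_toLp)

variable (𝕜)

theorem continuous_primitive : Continuous (g.primitive 𝕜) := by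
  refine AddMonoidHomClass.continuous_of_bound (g.primitive 𝕜) (√(g.measure.real univ))
    fun φ => UC.norm_le fun x => (norm_setIntegral_L2_le φ measurableSet_Iio).trans ?_
  gcongr
  exacts [measure_ne_top _ _, subset_univ _]

/-! ### Primitives of polynomials -/

theorem monomial_mem_polynomials (x₀ : Icc a b) (n : ℕ) :
    (fun x => (g.monomial x₀ n x : 𝕜)) ∈ g.polynomials 𝕜 :=
  Submodule.subset_span ⟨x₀, n, rfl⟩

theorem monomial_succ_eq (x₀ : Icc a b) (n : ℕ) (x : Icc a b) :
    g.monomial x₀ (n + 1) x = ((n + 1 : ℕ) : ℝ) * ((∫ t in Iio x, g.monomial x₀ n t ∂g.measure) -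
      ∫ t in Iio x₀, g.monomial x₀ n t ∂g.measure) := by
  have hi := (g.isUniformlyContinuous_monomial x₀ n).integrable
  simp only [monomial]
  split_ifs with h
  · rw [setIntegral_Iio_sub hi h]
  · rw [← setIntegral_Iio_sub hi (le_of_not_ge h)]
    ring

/-- Integrating from `a` instead of `x₀` changes `g_{x₀,n+1} / (n + 1)` by a constant, a multiple of
`g_{x₀,0}`. -/
theorem setIntegral_monomial_mem_polynomials (x₀ : Icc a b) (n : ℕ) :
    (fun x => ∫ t in Iio x, (g.monomial x₀ n t : 𝕜) ∂g.measure) ∈ g.polynomials 𝕜 := by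
  have h1 := (g.polynomials 𝕜).smul_mem ((n + 1 : ℕ) : 𝕜)⁻¹
    (g.monomial_mem_polynomials 𝕜 x₀ (n + 1))
  have h2 := (g.polynomials 𝕜).smul_mem (∫ t in Iio x₀, (g.monomial x₀ n t : 𝕜) ∂g.measure)
    (g.monomial_mem_polynomials 𝕜 x₀ 0)
  convert (g.polynomials 𝕜).add_mem h1 h2 using 1
  funext x
  have hn : ((n + 1 : ℕ) : 𝕜) ≠ 0 := Nat.cast_ne_zero.2 n.succ_ne_zero
  simp only [Pi.add_apply, Pi.smul_apply, smul_eq_mul]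
  rw [monomial_succ_eq, integral_ofReal, integral_ofReal, show g.monomial x₀ 0 x = 1 from rfl]
  push_cast at hn ⊢
  field_simp
  ring

theorem primitive_toL2_mem_polynomialsUC {p : g.UC 𝕜} (hp : p ∈ g.polynomialsUC 𝕜) :
    g.primitive 𝕜 (UC.toL2 g 𝕜 p) ∈ g.polynomialsUC 𝕜 := by
  have h : g.polynomials 𝕜 ≤ ((g.polynomialsUC 𝕜).comap
      (g.primitive 𝕜 ∘ₗ UC.toL2 g 𝕜)).map (g.ucSubmodule 𝕜).subtype := by
    refine Submodule.span_le.2 ?_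
    rintro _ ⟨x₀, n, rfl⟩
    have hm := g.polynomials_le_ucSubmodule 𝕜 (g.monomial_mem_polynomials 𝕜 x₀ n)
    refine ⟨⟨_, hm⟩, ?_, rfl⟩
    change _ ∈ g.polynomials 𝕜
    convert g.setIntegral_monomial_mem_polynomials 𝕜 x₀ n using 1
    exact funext fun x => g.primitive_toLp_apply (IsUniformlyContinuous.memLp hm) x
  obtain ⟨q, hq, hqp⟩ := h hp
  rwa [← (Subtype.ext hqp : q = p)]

theorem primitive_mem_closure {φ : g.L2 𝕜} (hφ : φ ∈ (g.polynomialsL2 𝕜).topologicalClosure) :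
    g.primitive 𝕜 φ ∈ (g.polynomialsUC 𝕜).topologicalClosure := by
  refine map_mem_closure (g.continuous_primitive 𝕜) hφ ?_
  rintro _ ⟨p, hp, rfl⟩
  exact g.primitive_toL2_mem_polynomialsUC 𝕜 hp

theorem toL2_mem_closure {f : g.UC 𝕜} (hf : f ∈ (g.polynomialsUC 𝕜).topologicalClosure) :
    UC.toL2 g 𝕜 f ∈ (g.polynomialsL2 𝕜).topologicalClosure :=
  map_mem_closure (UC.continuous_toL2 g 𝕜) hf fun _ hp => Submodule.mem_map_of_mem hp

theorem exists_one_mem_polynomialsUC : ∃ p ∈ g.polynomialsUC 𝕜, ∀ x, p x = 1 := by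
  have h := g.monomial_mem_polynomials 𝕜 ⟨a, le_rfl, g.le⟩ 0
  exact ⟨⟨_, g.polynomials_le_ucSubmodule 𝕜 h⟩, h, fun x => by simp [monomial]⟩

variable {g 𝕜}

/-! ### Weierstrass approximation in `UC_g` -/

theorem exists_mem_eq_eval {S : Submodule 𝕜 (g.UC 𝕜)} {u : Icc a b → ℝ}
    (hS : ∀ n : ℕ, ∃ p ∈ S, ∀ x, p x = (u x : 𝕜) ^ n) (q : Polynomial 𝕜) :
    ∃ p ∈ S, ∀ x, p x = q.eval (u x : 𝕜) := by
  induction q using Polynomial.induction_on' with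
  | add q r hq hr =>
    obtain ⟨p₁, h₁, e₁⟩ := hq
    obtain ⟨p₂, h₂, e₂⟩ := hr
    refine ⟨p₁ + p₂, S.add_mem h₁ h₂, fun x => ?_⟩
    rw [Polynomial.eval_add, ← e₁, ← e₂]
    rfl
  | monomial n c =>
    obtain ⟨p, h, e⟩ := hS n
    refine ⟨c • p, S.smul_mem c h, fun x => ?_⟩
    rw [Polynomial.eval_monomial, ← e]
    rfl

/-- If a subspace of `UC_g` contains the powers of `u`, then its closure contains the functions
which are uniformly continuous with respect to `u`. -/
theorem mem_topologicalClosure_of_pow_mem {S : Submodule 𝕜 (g.UC 𝕜)} {u : Icc a b → ℝ} {B : ℝ}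
    (hB : ∀ x, |u x| ≤ B) (hS : ∀ n : ℕ, ∃ p ∈ S, ∀ x, p x = (u x : 𝕜) ^ n) {f : g.UC 𝕜}
    (hf : ∀ ε > 0, ∃ δ > 0, ∀ x y, |u x - u y| < δ → ‖f x - f y‖ < ε) :
    f ∈ S.topologicalClosure := by
  have : Nonempty (Icc a b) := ⟨⟨a, le_rfl, g.le⟩⟩
  refine Metric.mem_closure_iff.2 fun ε hε => ?_
  obtain ⟨q, hq⟩ := exists_polynomial_comp_near hB f.norm_apply_le hf (half_pos hε)
  obtain ⟨p, hp, e⟩ := exists_mem_eq_eval hS q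
  refine ⟨p, hp, ?_⟩
  rw [dist_eq_norm]
  refine lt_of_le_of_lt (UC.norm_le (C := ε / 2) fun x => ?_) (half_lt_self hε)
  change ‖f x - p x‖ ≤ _
  rw [e]
  exact (hq x).le

variable (g 𝕜)

/-- If the closure of `S` contains all primitives and the constants, then `S` is dense. -/
theorem topologicalClosure_eq_top_of_primitive_mem {S : Submodule 𝕜 (g.UC 𝕜)}
    (h1 : ∃ p ∈ S, ∀ x, p x = 1) (hS : ∀ φ, g.primitive 𝕜 φ ∈ S.topologicalClosure) :
    S.topologicalClosure = ⊤ := by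
  refine eq_top_iff.2 fun f _ => ?_
  -- The powers are only known to lie in the closure, so Weierstrass is applied to the closure
  -- itself.
  rw [← S.isClosed_topologicalClosure.submodule_topologicalClosure_eq]
  refine mem_topologicalClosure_of_pow_mem (u := fun x => g.measure.real (Iio x))
    (B := g.measure.real univ) ?_ ?_ ?_
  · intro x
    rw [abs_of_nonneg measureReal_nonneg]
    exact measureReal_mono (subset_univ _)
  · rintro (_ | n)
    · obtain ⟨p, hp, e⟩ := h1
      exact ⟨p, S.le_topologicalClosure hp, fun x => by rw [e, pow_zero]⟩
    · have hm : MemLp (fun t => (powDensity g.measure n t : 𝕜)) 2 g.measure :=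
        MemLp.of_bound
          (RCLike.measurable_ofReal.comp (measurable_powDensity n)).aestronglyMeasurable _
          (Eventually.of_forall fun t => by
            rw [RCLike.norm_ofReal]; exact norm_powDensity_le n t)
      refine ⟨_, hS (hm.toLp _), fun x => ?_⟩
      rw [primitive_toLp_apply, integral_ofReal, setIntegral_powDensity]
      push_cast
      rfl
  · intro ε hε
    simpa only [measureReal_Iio, sub_sub_sub_cancel_right] using
      (f.2 : g.IsUniformlyContinuous f.1) ε hε

/-! ### Splitting off the atoms -/

variable {g 𝕜}

/-- The closure is the double orthogonal complement. Any `ψ` orthogonal to `K` is orthogonal to the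
indicators of the atoms, hence vanishes at each atom, and so is orthogonal to `φ`. -/
theorem mem_closure_of_ae_eq_zero {K : Submodule 𝕜 (g.L2 𝕜)}
    (hK : ∀ x ∈ g.atoms, g.indicatorL2 𝕜 x ∈ K.topologicalClosure) {φ : g.L2 𝕜}
    (hφ : ∀ᵐ t ∂g.measure, t ∉ g.atoms → φ t = 0) : φ ∈ K.topologicalClosure := by
  rw [← Submodule.orthogonal_orthogonal_eq_closure] at hK ⊢
  refine (Submodule.mem_orthogonal _ _).2 fun ψ hψ => ?_
  have h0 : ∀ x ∈ g.atoms, ψ x = 0 := by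
    intro x hx
    have h := (Submodule.mem_orthogonal' _ _).1 (hK x hx) ψ hψ
    rw [indicatorL2, L2.inner_indicatorConstLp_one, integral_singleton] at h
    refine (smul_eq_zero.1 h).resolve_left fun h' => ?_
    rw [measureReal_eq_zero_iff] at h'
    exact hx.ne' h'
  rw [L2.inner_def]
  refine integral_eq_zero_of_ae ?_
  filter_upwards [hφ] with t ht
  by_cases h : t ∈ g.atoms
  · simp [h0 t h]
  · simp [ht h]

theorem restrict_compl_atoms_singleton (t : Icc a b) :
    g.measure.restrict g.atomsᶜ {t} = 0 := by
  rw [Measure.restrict_apply (measurableSet_singleton t)]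
  by_cases h : t ∈ g.atoms
  · rw [(disjoint_compl_right.mono_left (singleton_subset_iff.2 h)).inter_eq, measure_empty]
  · exact measure_mono_null inter_subset_left (le_antisymm (not_lt.1 h) bot_le)

theorem memLp_indicator_compl_atoms (φ : g.L2 𝕜) :
    MemLp (g.atomsᶜ.indicator φ) 2 g.measure :=
  (Lp.memLp φ).indicator g.measurableSet_atoms.compl

theorem sub_indicator_mem_closure {K : Submodule 𝕜 (g.L2 𝕜)}
    (hK : ∀ x ∈ g.atoms, g.indicatorL2 𝕜 x ∈ K.topologicalClosure) (φ : g.L2 𝕜) :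
    φ - (memLp_indicator_compl_atoms φ).toLp _ ∈ K.topologicalClosure := by
  refine mem_closure_of_ae_eq_zero hK ?_
  filter_upwards [Lp.coeFn_sub φ ((memLp_indicator_compl_atoms φ).toLp _),
    (memLp_indicator_compl_atoms φ).coeFn_toLp] with t h1 h2 ht
  rw [h1, Pi.sub_apply, h2, indicator_of_mem ht, sub_self]

/-- The powers of the distribution function of the atomless part of `μ_g` are uniform limits of
`g`-polynomials. -/
theorem pow_mem_closure (hK : ∀ x ∈ g.atoms,
      g.indicatorL2 𝕜 x ∈ (g.polynomialsL2 𝕜).topologicalClosure) (n : ℕ) :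
    ∃ p ∈ (g.polynomialsUC 𝕜).topologicalClosure,
      ∀ x, p x = ((g.measure.restrict g.atomsᶜ).real (Iio x) : 𝕜) ^ n := by
  induction n with
  | zero =>
    obtain ⟨p, hp, e⟩ := g.exists_one_mem_polynomialsUC 𝕜
    exact ⟨p, Submodule.le_topologicalClosure _ hp, fun x => by rw [e, pow_zero]⟩
  | succ n ih =>
    obtain ⟨p, hp, e⟩ := ih
    -- The `n`-th power, cut off on the atoms, is still an `L²_g`-limit of `g`-polynomials.
    have hψ := (Submodule.sub_mem_iff_right _ (g.toL2_mem_closure 𝕜 hp)).1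
      (sub_indicator_mem_closure hK (UC.toL2 g 𝕜 p))
    refine ⟨_, Submodule.smul_mem _ ((n : 𝕜) + 1) (g.primitive_mem_closure 𝕜 hψ), fun x => ?_⟩
    change ((n : 𝕜) + 1) * g.primitive 𝕜 _ x = _
    rw [primitive_toLp_apply, setIntegral_indicator g.measurableSet_atoms.compl,
      ← Measure.restrict_restrict measurableSet_Iio]
    have h1 : ∀ᵐ t ∂(g.measure.restrict g.atomsᶜ).restrict (Iio x), UC.toL2 g 𝕜 p t =
        (((g.measure.restrict g.atomsᶜ).real (Iio t) ^ n : ℝ) : 𝕜) := by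
      filter_upwards [ae_restrict_of_ae (ae_restrict_of_ae (UC.coeFn_toL2 g 𝕜 p))] with t ht
      rw [ht, e]
      push_cast
      rfl
    have h2 := setIntegral_powDensity (ν := g.measure.restrict g.atomsᶜ) n x
    simp only [powDensity_eq_of_measure_singleton (restrict_compl_atoms_singleton _)] at h2
    rw [integral_const_mul] at h2
    rw [integral_congr_ae h1, integral_ofReal]
    exact_mod_cast congrArg (RCLike.ofReal (K := 𝕜)) h2

/-- The part of `φ` on the atoms is an `L²_g`-limit of `g`-polynomials. The primitive of the rest is
`1/2`-Hölder in the atomless distribution function, whose powers are available. -/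
theorem primitive_mem_closure_of_indicatorL2_mem (hK : ∀ x ∈ g.atoms,
      g.indicatorL2 𝕜 x ∈ (g.polynomialsL2 𝕜).topologicalClosure) (φ : g.L2 𝕜) :
    g.primitive 𝕜 φ ∈ (g.polynomialsUC 𝕜).topologicalClosure := by
  have h1 := g.primitive_mem_closure 𝕜 (sub_indicator_mem_closure hK φ)
  rw [map_sub] at h1
  refine (Submodule.sub_mem_iff_left _ ?_).1 h1
  rw [← (g.polynomialsUC 𝕜).isClosed_topologicalClosure.submodule_topologicalClosure_eq]
  refine mem_topologicalClosure_of_pow_mem (B := (g.measure.restrict g.atomsᶜ).real univ) ?_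
    (pow_mem_closure hK) ?_
  · intro x
    rw [abs_of_nonneg measureReal_nonneg]
    exact measureReal_mono (subset_univ _)
  · intro ε hε
    refine isUniformlyContinuous_of_norm_sub_le (C := ‖φ‖) (fun x y => ?_) hε
    rw [primitive_toLp_apply, primitive_toLp_apply]
    exact norm_setIntegral_Iio_sub_le φ g.measurableSet_atoms.compl x y

/-! ### Approximation of the indicators of jump points -/

variable (g)

/-- The tent of slope `n` in `g` with top at `x`. -/
def tent (x : Icc a b) (n : ℕ) (y : Icc a b) : ℝ := max 0 (1 - n * |g y - g x|)

theorem isUniformlyContinuous_tent (x : Icc a b) (n : ℕ) :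
    g.IsUniformlyContinuous fun y => (g.tent x n y : 𝕜) := by
  intro ε hε
  -- The tent is `n`-Lipschitz in `g`; `n + 1` covers `n = 0`.
  refine ⟨ε / (n + 1), by positivity, fun y z h => ?_⟩
  rw [lt_div_iff₀ (by positivity)] at h
  rw [← RCLike.ofReal_sub, RCLike.norm_ofReal]
  have h1 : |g.tent x n y - g.tent x n z| ≤ n * |g y - g z| := by
    refine le_trans (abs_max_sub_max_le_max _ _ _ _) (max_le ?_ ?_)
    · rw [sub_self, abs_zero]
      positivity
    rw [sub_sub_sub_cancel_left, ← mul_sub, abs_mul, Nat.abs_cast]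
    refine mul_le_mul_of_nonneg_left ?_ n.cast_nonneg
    refine le_trans (abs_abs_sub_abs_le _ _) (le_of_eq ?_)
    rw [sub_sub_sub_cancel_right, abs_sub_comm]
  nlinarith [abs_nonneg (g y - g z)]

theorem tendsto_tent (x y : Icc a b) :
    Tendsto (fun n => g.tent x n y) atTop (𝓝 ({y | g y = g x}.indicator 1 y)) := by
  by_cases h : g y = g x
  · rw [indicator_of_mem (show y ∈ {y | g y = g x} from h)]
    simp [tent, h]
  · rw [indicator_of_notMem (show y ∉ {y | g y = g x} from h)]
    have hpos : 0 < |g y - g x| := abs_pos.2 (sub_ne_zero.2 h)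
    refine tendsto_const_nhds.congr' ?_
    filter_upwards [eventually_ge_atTop ⌈1 / |g y - g x|⌉₊] with n hn
    have := Nat.ceil_le.1 hn
    rw [div_le_iff₀ hpos] at this
    rw [tent, max_eq_left (by linarith)]

variable {g}

/-- The jump excludes points to the right of `x`. The level set may extend to the left, but only by
a null set. -/
theorem level_ae_eq_singleton {x : Icc a b} (hx : x ∈ g.jumpSet) :
    {y | g y = g x} =ᵐ[g.measure] ({x} : Set (Icc a b)) := by
  have h : ∀ᵐ y ∂g.measure, y ∉ {y | y < x ∧ g.measure (Ico y x) = 0} :=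
    measure_eq_zero_iff_ae_notMem.1 (measure_level_left_eq_zero x)
  filter_upwards [h] with y hy
  refine propext ⟨fun (hyx : g y = g x) => ?_, fun (hyx : y = x) => congrArg g hyx⟩
  rcases lt_trichotomy y x with hlt | heq | hgt
  · exact absurd ⟨hlt, by rw [measure_Ico, hyx, sub_self, ENNReal.ofReal_zero]⟩ hy
  · exact heq
  · have h1 := g.monotone.rightLim_le hgt
    have h2 : 0 < Function.rightLim g x - g x := hx.2
    linarith

/-- Any `ψ` orthogonal to `K` is orthogonal to all tents. Dominated convergence passes this to the
level set of `x`, which is `{x}` almost everywhere. -/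
theorem indicatorL2_mem_closure {K : Submodule 𝕜 (g.L2 𝕜)}
    (hK : ∀ f, UC.toL2 g 𝕜 f ∈ K.topologicalClosure) {x : Icc a b} (hx : x ∈ g.jumpSet) :
    g.indicatorL2 𝕜 x ∈ K.topologicalClosure := by
  rw [← Submodule.orthogonal_orthogonal_eq_closure] at hK ⊢
  refine (Submodule.mem_orthogonal' _ _).2 fun ψ hψ => ?_
  rw [indicatorL2, L2.inner_indicatorConstLp_one, ← setIntegral_congr_set
    (level_ae_eq_singleton hx)]
  have hm : MeasurableSet {y | g y = g x} :=
    g.monotone.measurable (measurableSet_singleton (g x))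
  rw [← integral_indicator hm]
  have h0 : ∀ n, ∫ y, (g.tent x n y : 𝕜) * ψ y ∂g.measure = 0 := by
    intro n
    have hu := g.isUniformlyContinuous_tent (𝕜 := 𝕜) x n
    have h := (Submodule.mem_orthogonal' _ _).1 (hK ⟨_, hu⟩) ψ hψ
    rw [L2.inner_def] at h
    rw [← h]
    refine integral_congr_ae ?_
    filter_upwards [UC.coeFn_toL2 g 𝕜 ⟨_, hu⟩] with y hy
    rw [hy, RCLike.inner_apply, RCLike.conj_ofReal, mul_comm]
  refine tendsto_nhds_unique (tendsto_integral_of_dominated_convergence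
    (F := fun n y => (g.tent x n y : 𝕜) * ψ y) (fun y => ‖ψ y‖) (fun n => ?_)
    (integrable_L2 ψ).norm (fun n => Eventually.of_forall fun y => ?_)
    (Eventually.of_forall fun y => ?_)) (by simp only [h0]; exact tendsto_const_nhds)
  · exact (g.isUniformlyContinuous_tent (𝕜 := 𝕜) x n).measurable.aestronglyMeasurable.mul
      (Lp.aestronglyMeasurable ψ)
  · rw [norm_mul, RCLike.norm_ofReal]
    refine mul_le_of_le_one_left (norm_nonneg _) ?_
    rw [tent, abs_of_nonneg (le_max_left _ _)]
    exact max_le zero_le_one (sub_le_self _ (by positivity))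
  · have h := ((RCLike.continuous_ofReal (K := 𝕜)).tendsto _).comp (g.tendsto_tent x y)
    convert h.mul_const (ψ y) using 2
    · rfl
    by_cases hy : y ∈ {y | g y = g x}
    · rw [indicator_of_mem (s := {y | g y = g x}) hy, indicator_of_mem (s := {y | g y = g x}) hy,
        Pi.one_apply, RCLike.ofReal_one, one_mul]
    · rw [indicator_of_notMem (s := {y | g y = g x}) hy,
        indicator_of_notMem (s := {y | g y = g x}) hy, RCLike.ofReal_zero, zero_mul]

end Derivator

end

end StieltjesCalculus

theorem mainTheorem3 (𝕜 : Type*) [RCLike 𝕜] {a b : ℝ}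
    (g : StieltjesCalculus.Derivator a b) :
    Dense (g.polynomialsUC 𝕜 : Set (g.UC 𝕜)) ↔
      ∀ x ∈ g.jumpSet, g.indicatorL2 𝕜 x ∈ closure (g.polynomialsL2 𝕜 : Set (g.L2 𝕜)) := by
  rw [Submodule.dense_iff_topologicalClosure_eq_top]
  constructor
  · intro h x hx
    exact StieltjesCalculus.Derivator.indicatorL2_mem_closure
      (fun f => g.toL2_mem_closure 𝕜 (h ▸ Submodule.mem_top)) hx
  · intro h
    exact g.topologicalClosure_eq_top_of_primitive_mem 𝕜 (g.exists_one_mem_polynomialsUC 𝕜)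
      (StieltjesCalculus.Derivator.primitive_mem_closure_of_indicatorL2_mem
        fun x hx => h x (g.atoms_subset_jumpSet hx))
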